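/- **Setting.** Let $D=\{d_1<\dots<d_m\}$ be a finite set of real numbers with $d_1=0$. For $x\in(0,1)$ and $\omega\in D^{\mathbb N}$ put $\Pi_x(\omega)=\sum_{i\ge 0}\omega_i x^i$, and for $\gamma,\lambda\in(0,1)$ put $\Pi_{\gamma,\lambda}(\omega)=(\Pi_\gamma(\omega),\Pi_\lambda(\omega))\in\mathbb R^2$. Let $\mathcal B$ be the set of power series $\sum_{i\ge0}c_ix^i$ with $c_i\in D-D$ for all $i$ and $c_0\ne0$; a double root of $f\in\mathcal B$ is a point $x\in(-1,1)$ with $f(x)=f'(x)=0$. For $\omega,\omega'\in D^{\mathbb N}$ let $i(\omega,\omega')$ be the length of their longest common initial block, and for a Borel probability measure $\rho$ on $D^{\mathbb N}$ let $$\underline{\dim}_2(\rho)=\liminf_{k\to\infty}\frac{-\log\big((\rho\times\rho)\{(\omega,\omega'):i(\omega,\omega')=k\}\big)}{k\log m}\in[0,\infty]$$ (with $-\log 0=\infty$ and $m^{-\infty}=0$). For real $a<b$ let $$\Gamma(a,b)=\{(\gamma,\lambda)\in(0,1)^2:\ \gamma<\lambda,\ 1/m<\lambda,\ a<\gamma\lambda<b\},$$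 and let $\Gamma(a,b)=\varnothing$ if $a\ge b$. **Theorem.** Let $\rho=\mathbf p^{\mathbb N}$ be a product measure on $D^{\mathbb N}$, where $\mathbf p$ is a probability vector on $D$. Let $\nu_\lambda=\rho\circ\Pi_\lambda^{-1}$ and $\mu_{\gamma,\lambda}=\rho\circ\Pi_{\gamma,\lambda}^{-1}$. Let $I,J\subset(1/m,1)$ be open intervals and let $R\subset\mathbb R^2$ be open. Assume that: 1. $\displaystyle\int_{I'}\Big\|\frac{d\nu_\lambda}{dx}\Big\|_2^2\,d\lambda<\infty$ whenever $I'$ is compactly contained in $I$, where $\|d\nu_\lambda/dx\|_2=\infty$ if $\nu_\lambda$ does not have a density in $L^2$; 2. no $f\in\mathcal B$ has a double root in $J$; 3. if $(\gamma,\lambda)\in R$ and $f\in\mathcal B$, then $\gamma$ and $\lambda$ are not both double roots of $f$. Let $$\mathcal S_1=R\cap(I\times I)\cap\Gamma\big(m^{-\underline{\dim}_2(\rho)},1\big),\qquad \mathcal S_2=(J\times I)\cap\Gamma\big(m^{-\underline{\dim}_2(\rho)},1\big).$$ Then for Lebesgue-almost every $(\gamma,\lambda)\in\mathcal S_1\cup\mathcal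 S_2$ the measure $\mu_{\gamma,\lambda}$ is absolutely continuous with respect to Lebesgue measure on $\mathbb R^2$, with a density in $L^2$. -/

import Mathlib

open MeasureTheory Filter Set
open scoped ENNReal

namespace SelfAffine

noncomputable section

/-- The symbolic space `D^ℕ` over a finite set `D` of real digits. -/
abbrev Seq (D : Finset ℝ) : Type := ℕ → ↥D

/-- The Bernoulli measure `p^ℕ` on `D^ℕ`: the infinite product of copies of a probability
measure `p` on the set of digits. -/
def bernoulliMeasure (D : Finset ℝ) (p : ProbabilityMeasure ↥D) : Measure (Seq D) :=
  Measure.infinitePi (fun _ : ℕ => (p : Measure ↥D))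

instance (D : Finset ℝ) (p : ProbabilityMeasure ↥D) : IsProbabilityMeasure (bernoulliMeasure D p) := by
  unfold bernoulliMeasure; infer_instance

/-- The value `∑ cᵢ xⁱ` of the power series with coefficients `c` (meant for `|x| < 1`). -/
def powerSum (c : ℕ → ℝ) (x : ℝ) : ℝ := ∑' i, c i * x ^ i

/-- The coding map `Π_x : D^ℕ → ℝ`, `ω ↦ ∑ ωᵢ xⁱ`. -/
def proj (D : Finset ℝ) (x : ℝ) (ω : Seq D) : ℝ := powerSum (fun i => (ω i : ℝ)) x

/-- The coding map `Π_{γ,l} : D^ℕ → ℝ²`, `ω ↦ (∑ ωᵢ γⁱ, ∑ ωᵢ lⁱ)`. -/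
def proj₂ (D : Finset ℝ) (γ l : ℝ) (ω : Seq D) : ℝ × ℝ := (proj D γ ω, proj D l ω)

/-- `ν_l = ρ ∘ Π_l⁻¹`. -/
def nu (D : Finset ℝ) (ρ : Measure (Seq D)) (l : ℝ) : Measure ℝ := ρ.map (proj D l)

/-- `μ_{γ,l} = ρ ∘ Π_{γ,l}⁻¹`. -/
def mu (D : Finset ℝ) (ρ : Measure (Seq D)) (γ l : ℝ) : Measure (ℝ × ℝ) := ρ.map (proj₂ D γ l)

open Classical in
/-- The squared `L²` norm of the density of `ν` with respect to Lebesgue measure; it is `∞` if `ν`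
is not absolutely continuous, or if its density is not square integrable. -/
def sqNormDensity (ν : Measure ℝ) : ℝ≥0∞ :=
  if ν ≪ volume then ∫⁻ x, (ν.rnDeriv volume x) ^ 2 else ⊤

/-- `μ` is absolutely continuous with respect to Lebesgue measure on `ℝ²`, with a density
in `L²`. -/
def HasL2Density (μ : Measure (ℝ × ℝ)) : Prop :=
  ∃ g : ℝ × ℝ → ℝ≥0∞, Measurable g ∧ μ = volume.withDensity g ∧ ∫⁻ z, (g z) ^ 2 < ⊤

/-- The class `𝓑` of power series with coefficients in `D - D` and non-zero constant term,
given by their coefficient sequences. -/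
def classB (D : Finset ℝ) : Set (ℕ → ℝ) :=
  {c | (∀ i, ∃ a ∈ D, ∃ b ∈ D, c i = a - b) ∧ c 0 ≠ 0}

/-- `x` is a double root (a root of multiplicity at least two) of the power series with bounded
coefficients `c`; such a series defines a function on `(-1, 1)`. -/
def IsDoubleRoot (c : ℕ → ℝ) (x : ℝ) : Prop :=
  x ∈ Ioo (-1 : ℝ) 1 ∧ powerSum c x = 0 ∧ deriv (powerSum c) x = 0

/-- The lower correlation dimension of a measure `ρ` on `D^ℕ`,
`liminf_k -log (ρ × ρ){(ω, ω') : i(ω, ω') = k} / (k log m)` with `m = |D|`, where `i(ω, ω')` is the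
length of the longest common initial block of `ω` and `ω'`. It may be `∞` (`log 0 = -∞`). -/
def corrDim (D : Finset ℝ) (ρ : Measure (Seq D)) : EReal :=
  liminf (fun k : ℕ =>
    -ENNReal.log ((ρ.prod ρ) {w | (∀ i < k, w.1 i = w.2 i) ∧ w.1 k ≠ w.2 k}) /
      ((k * Real.log D.card : ℝ) : EReal)) atTop

/-- The number `m ^ (-dim₂ ρ)`, where `m = |D|` (equal to `0` if `dim₂ ρ = ∞`). -/
def threshold (D : Finset ℝ) (ρ : Measure (Seq D)) : ℝ :=
  (EReal.exp (-(corrDim D ρ * ((Real.log D.card : ℝ) : EReal)))).toReal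

/-- `Γ(a, b) = {(γ, l) ∈ (0,1)² : γ < l, 1/m < l, a < γ l < b}`. -/
def Gam (m : ℕ) (a b : ℝ) : Set (ℝ × ℝ) :=
  {z | z.1 ∈ Ioo (0 : ℝ) 1 ∧ z.2 ∈ Ioo (0 : ℝ) 1 ∧ z.1 < z.2 ∧ 1 / (m : ℝ) < z.2 ∧
    z.1 * z.2 ∈ Ioo a b}

end

end SelfAffine

open SelfAffine

open SelfAffine

namespace SelfAffine

open scoped Topology

/-! A measure `μ` on the plane has a density in `L²` as soon as `(μ × μ){dist ≤ r} / r²` has finite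
liminf as `r → 0`. By Fatou it is enough to bound the integral of `(ρ × ρ)(closePairs D z r r)` over
a small rectangle `U ×ˢ V` of parameters by a constant times `r²`.

Let `q = ∑ p(d)²` be `collisionProb`. Two independent sequences agree on their first `k` digits with
probability `q ^ k`, and the remaining tails are again independent with law `ρ`. The difference
series is then `x ^ k` times the series `f` of the tails, so closeness at scale `r` becomes `|f(γ)|
≤ s = r / u ^ k` and `|f(λ)| ≤ t = r / v ^ k`, where `u`, `v` are lower bounds for the parameters
(`prod_closePairs_le_tsum`).

If the tails differ in their first digit, then `f ∈ 𝓑`. Fubini turns the integral into the mean of a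
product of two lengths, one in `U` and one in `V`. At one of the two parameters `f` has no double
root; by compactness of `𝓑` this gives transversality there, and that length is `O(s)` or `O(t)`
uniformly in `f`. The mean of the other length is controlled, by Fubini in reverse, by the integral
of `‖dν/dx‖₂²` over its interval, which must then lie in `I`. Each `k` thus contributes `O(r² (q /
uv) ^ k)`, and the series converges since `q < uv` near the given pair. Finally `q` is the threshold
`m ^ (-dim₂ ρ)` when `0 < q < 1` (`threshold_bernoulliMeasure`). -/

/-! ### Correlation integrals and densities in `L²` -/

theorem prod_apply_dist_le {X : Type*} [PseudoMetricSpace X] [SecondCountableTopology X]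
    [MeasurableSpace X] [BorelSpace X] (μ ν : Measure X) [SFinite ν] (r : ℝ) :
    (μ.prod ν) {w | dist w.1 w.2 ≤ r} = ∫⁻ x, ν (Metric.closedBall x r) ∂μ := by
  rw [Measure.prod_apply (measurableSet_le (measurable_fst.dist measurable_snd) measurable_const)]
  refine lintegral_congr fun x => ?_
  congr 1
  ext y
  simp [dist_comm]

theorem measurable_measure_closedBall {X : Type*} [PseudoMetricSpace X]
    [SecondCountableTopology X] [MeasurableSpace X] [BorelSpace X] (ν : Measure X) [SFinite ν]
    (r : ℝ) : Measurable fun x => ν (Metric.closedBall x r) := by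
  have h := measurable_measure_prodMk_left (ν := ν)
    (measurableSet_le (measurable_fst.dist measurable_snd) measurable_const :
      MeasurableSet {w : X × X | dist w.1 w.2 ≤ r})
  convert! h using 3 with x
  ext y
  simp [dist_comm]

/-- A finite measure is absolutely continuous as soon as the reference measure has almost
everywhere positive derivative with respect to it. -/
theorem absolutelyContinuous_of_rnDeriv_ne_zero {X : Type*} [MeasurableSpace X]
    (μ ν : Measure X) (h : ∀ᵐ x ∂μ, ν.rnDeriv μ x ≠ 0) : μ ≪ ν := by
  refine Measure.AbsolutelyContinuous.mk fun s hs hνs => ?_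
  have h0 : ∫⁻ x in s, ν.rnDeriv μ x ∂μ = 0 :=
    le_antisymm ((Measure.setLIntegral_rnDeriv_le s).trans hνs.le) bot_le
  rw [lintegral_eq_zero_iff (Measure.measurable_rnDeriv _ _)] at h0
  have h1 : ∀ᵐ x ∂(μ.restrict s), False := by
    filter_upwards [h0, ae_restrict_of_ae h] with x hx hx' using hx' hx
  simpa [ae_iff] using h1

theorem volume_closedBall_prod (x : ℝ × ℝ) (r : ℝ) :
    volume (Metric.closedBall x r) = 4 * ENNReal.ofReal r ^ 2 := by
  rw [← closedBall_prod_same, Measure.volume_eq_prod, Measure.prod_prod, Real.volume_closedBall,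
    Real.volume_closedBall, ENNReal.ofReal_mul (by norm_num)]
  norm_num
  ring

/-- Lebesgue measure is differentiated with respect to `μ`, not conversely: the limit then exists
`μ`-almost everywhere before absolute continuity is known. Fatou makes the reciprocal derivative
`μ`-integrable, hence the derivative is nonzero, `μ` is absolutely continuous, and `∫ g² = ∫ g dμ`
is that same integral. -/
theorem hasL2Density_of_liminf (μ : Measure (ℝ × ℝ)) [IsFiniteMeasure μ] (r : ℕ → ℝ)
    (hr : ∀ n, 0 < r n) (hr0 : Tendsto r atTop (𝓝 0))
    (h : liminf (fun n => (μ.prod μ) {w | dist w.1 w.2 ≤ r n} / ENNReal.ofReal (r n) ^ 2) atTop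
      < ⊤) : HasL2Density μ := by
  set ρ := (volume : Measure (ℝ × ℝ)).rnDeriv μ with hρ
  have hlim : ∀ᵐ x ∂μ, Tendsto (fun n => (μ (Metric.closedBall x (r n))) /
      volume (Metric.closedBall x (r n))) atTop (𝓝 (ρ x)⁻¹) := by
    filter_upwards [Besicovitch.ae_tendsto_rnDeriv volume μ] with x hx
    have h1 := hx.comp (tendsto_nhdsWithin_iff.2 ⟨hr0, Eventually.of_forall hr⟩)
    have h2 := (continuous_inv.tendsto _).comp h1
    refine h2.congr fun n => ?_
    simp only [Function.comp]
    exact ENNReal.inv_div (Or.inr measure_closedBall_lt_top.ne)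
      (Or.inr (Metric.measure_closedBall_pos _ _ (hr n)).ne')
  have hint : ∫⁻ x, (ρ x)⁻¹ ∂μ < ⊤ := by
    have h1 : ∫⁻ x, (ρ x)⁻¹ ∂μ = ∫⁻ x, liminf (fun n => (μ (Metric.closedBall x (r n))) /
      volume (Metric.closedBall x (r n))) atTop ∂μ := by
      refine lintegral_congr_ae ?_
      filter_upwards [hlim] with x hx using hx.liminf_eq.symm
    rw [h1]
    refine (lintegral_liminf_le fun n => ?_).trans_lt ?_
    · exact (measurable_measure_closedBall μ _).div (measurable_measure_closedBall volume _)
    · refine lt_of_le_of_lt ?_ h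
      refine liminf_le_liminf (Eventually.of_forall fun n => ?_)
      simp only [volume_closedBall_prod, div_eq_mul_inv]
      rw [lintegral_mul_const _ (measurable_measure_closedBall μ _), ← prod_apply_dist_le]
      gcongr
      calc ENNReal.ofReal (r n) ^ 2 = 1 * ENNReal.ofReal (r n) ^ 2 := by ring
        _ ≤ _ := by gcongr; norm_num
  have hρm : Measurable ρ := Measure.measurable_rnDeriv _ _
  have hac : μ ≪ volume := by
    refine absolutelyContinuous_of_rnDeriv_ne_zero _ _ ?_
    filter_upwards [ae_lt_top hρm.inv hint.ne] with x hx
    rw [Pi.inv_apply, ENNReal.inv_lt_top] at hx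
    exact hx.ne'
  refine ⟨μ.rnDeriv volume, Measure.measurable_rnDeriv _ _,
    (Measure.withDensity_rnDeriv_eq _ _ hac).symm, ?_⟩
  simp only [pow_two]
  rw [lintegral_rnDeriv_mul hac (Measure.measurable_rnDeriv _ _).aemeasurable]
  refine lt_of_le_of_lt (le_of_eq (lintegral_congr_ae ?_)) hint
  filter_upwards [Measure.inv_rnDeriv hac] with x hx
  rw [hρ, ← hx]
  simp

theorem prod_dist_le_le_sqNormDensity (ν : Measure ℝ) [IsFiniteMeasure ν] {r : ℝ} (hr : 0 < r) :
    (ν.prod ν) {w | dist w.1 w.2 ≤ r} ≤ 4 * ENNReal.ofReal r * sqNormDensity ν := by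
  unfold sqNormDensity
  split_ifs with hac
  swap
  · rw [ENNReal.mul_top (by simp [hr])]
    exact le_top
  set f := ν.rnDeriv volume with hf
  have hfm : Measurable f := Measure.measurable_rnDeriv _ _
  have hS : MeasurableSet {w : ℝ × ℝ | dist w.1 w.2 ≤ r} :=
    measurableSet_le (measurable_fst.dist measurable_snd) measurable_const
  have key : ∫⁻ x : ℝ, ∫⁻ y : ℝ in Metric.closedBall x r, f x ^ 2 = 2 * ENNReal.ofReal r *
      ∫⁻ x, f x ^ 2 := by
    simp only [lintegral_const, Measure.restrict_apply_univ, Real.volume_closedBall]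
    rw [lintegral_mul_const _ (hfm.pow_const 2), ENNReal.ofReal_mul (by norm_num), mul_comm]
    norm_num
  have hI : ∀ g : ℝ × ℝ → ℝ≥0∞, Measurable g → ∫⁻ w in {w : ℝ × ℝ | dist w.1 w.2 ≤ r}, g w =
      ∫⁻ x, ∫⁻ y in Metric.closedBall x r, g (x, y) := by
    intro g hg
    rw [← lintegral_indicator hS, Measure.volume_eq_prod,
      lintegral_prod _ (hg.indicator hS).aemeasurable]
    refine lintegral_congr fun x => ?_
    rw [← lintegral_indicator measurableSet_closedBall]
    refine lintegral_congr fun y => ?_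
    simp [indicator, dist_comm]
  have hsymm : ∫⁻ w in {w : ℝ × ℝ | dist w.1 w.2 ≤ r}, f w.2 ^ 2 =
      ∫⁻ w in {w : ℝ × ℝ | dist w.1 w.2 ≤ r}, f w.1 ^ 2 := by
    rw [← lintegral_indicator hS, ← lintegral_indicator hS, Measure.volume_eq_prod,
      ← lintegral_prod_swap]
    refine lintegral_congr fun y => ?_
    simp [indicator, dist_comm]
  have hν : ν = volume.withDensity f := (Measure.withDensity_rnDeriv_eq _ _ hac).symm
  calc (ν.prod ν) {w | dist w.1 w.2 ≤ r}
      = ∫⁻ w in {w : ℝ × ℝ | dist w.1 w.2 ≤ r}, f w.1 * f w.2 := by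
        conv_lhs => rw [hν]
        rw [prod_withDensity hfm hfm, withDensity_apply _ hS, Measure.volume_eq_prod]
    _ ≤ ∫⁻ w in {w : ℝ × ℝ | dist w.1 w.2 ≤ r}, (f w.1 ^ 2 + f w.2 ^ 2) := by
        refine lintegral_mono fun w => ?_
        -- The crude bound `ab ≤ a² + b²` costs a factor 2, whence the constant 4.
        rcases le_total (f w.1) (f w.2) with h | h
        · calc f w.1 * f w.2 ≤ f w.2 * f w.2 := by gcongr
            _ = f w.2 ^ 2 := by ring
            _ ≤ _ := le_add_self
        · calc f w.1 * f w.2 ≤ f w.1 * f w.1 := by gcongr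
            _ = f w.1 ^ 2 := by ring
            _ ≤ _ := le_self_add
    _ = 4 * ENNReal.ofReal r * ∫⁻ x, f x ^ 2 := by
        rw [lintegral_add_left (by fun_prop), hsymm, hI _ (by fun_prop), key]
        ring

/-! ### Power series with bounded coefficients -/

theorem summable_mul_geometric (M : ℝ) {q : ℝ} (hq0 : 0 ≤ q) (hq1 : q < 1) :
    Summable fun i : ℕ => M * q ^ i :=
  (summable_geometric_of_lt_one hq0 hq1).mul_left M

theorem summable_mul_deriv_geometric (M : ℝ) {q : ℝ} (hq0 : 0 ≤ q) (hq1 : q < 1) :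
    Summable fun i : ℕ => M * (i * q ^ (i - 1)) := by
  refine Summable.mul_left M ?_
  rw [← summable_nat_add_iff 1]
  have h1 := summable_pow_mul_geometric_of_norm_lt_one 1 (r := q) (by rwa [Real.norm_of_nonneg hq0])
  have h2 := summable_geometric_of_lt_one hq0 hq1
  refine (h1.add h2).congr fun i => ?_
  simp
  ring

theorem norm_mul_pow_le {c : ℕ → ℝ} {M q x : ℝ} (hc : ∀ i, |c i| ≤ M) (hx : |x| ≤ q) (i : ℕ) :
    ‖c i * x ^ i‖ ≤ M * q ^ i := by
  rw [norm_mul, norm_pow, Real.norm_eq_abs, Real.norm_eq_abs]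
  have := (abs_nonneg _).trans (hc i)
  gcongr
  exact hc i

theorem norm_mul_deriv_pow_le {c : ℕ → ℝ} {M q x : ℝ} (hc : ∀ i, |c i| ≤ M) (hx : |x| ≤ q)
    (i : ℕ) : ‖c i * (i * x ^ (i - 1))‖ ≤ M * (i * q ^ (i - 1)) := by
  rw [norm_mul, norm_mul, norm_pow, Real.norm_natCast, Real.norm_eq_abs, Real.norm_eq_abs]
  have := (abs_nonneg _).trans (hc i)
  gcongr
  exact hc i

theorem summable_powerSum {c : ℕ → ℝ} {M x : ℝ} (hc : ∀ i, |c i| ≤ M) (hx : |x| < 1) :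
    Summable fun i => c i * x ^ i :=
  Summable.of_norm_bounded (summable_mul_geometric M (abs_nonneg x) hx)
    (norm_mul_pow_le hc le_rfl)

theorem hasDerivAt_powerSum {c : ℕ → ℝ} {M x : ℝ} (hc : ∀ i, |c i| ≤ M) (hx : |x| < 1) :
    HasDerivAt (powerSum c) (∑' i : ℕ, c i * (i * x ^ (i - 1))) x := by
  obtain ⟨q, hxq, hq1⟩ := exists_between hx
  have hq0 : 0 < q := (abs_nonneg x).trans_lt hxq
  refine hasDerivAt_tsum_of_isPreconnected (g := fun i y => c i * y ^ i)
    (g' := fun i y => c i * (i * y ^ (i - 1))) (t := Ioo (-q) q)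
    (summable_mul_deriv_geometric M hq0.le hq1) isOpen_Ioo isPreconnected_Ioo
    (fun i y _ => (hasDerivAt_pow i y).const_mul (c i))
    (fun i y hy => norm_mul_deriv_pow_le hc (abs_lt.2 hy).le i)
    (y₀ := x) (abs_lt.1 hxq) (summable_powerSum hc hx) (abs_lt.1 hxq)

theorem continuousOn_powerSum (M : ℝ) {q : ℝ} (hq0 : 0 ≤ q) (hq1 : q < 1) :
    ContinuousOn (fun z : (ℕ → ℝ) × ℝ => powerSum z.1 z.2)
      ({c | ∀ i, |c i| ≤ M} ×ˢ {x | |x| ≤ q}) :=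
  continuousOn_tsum (fun i => by fun_prop) (summable_mul_geometric M hq0 hq1)
    (fun i _ hz => norm_mul_pow_le hz.1 hz.2 i)

theorem continuousOn_deriv_powerSum (M : ℝ) {q : ℝ} (hq0 : 0 ≤ q) (hq1 : q < 1) :
    ContinuousOn (fun z : (ℕ → ℝ) × ℝ => deriv (powerSum z.1) z.2)
      ({c | ∀ i, |c i| ≤ M} ×ˢ {x | |x| ≤ q}) := by
  have h : ContinuousOn (fun z : (ℕ → ℝ) × ℝ => ∑' i : ℕ, z.1 i * (i * z.2 ^ (i - 1)))
      ({c | ∀ i, |c i| ≤ M} ×ˢ {x | |x| ≤ q}) :=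
    continuousOn_tsum (fun i => by fun_prop) (summable_mul_deriv_geometric M hq0 hq1)
      (fun i _ hz => norm_mul_deriv_pow_le hz.1 hz.2 i)
  exact h.congr fun z hz => (hasDerivAt_powerSum hz.1 (hz.2.trans_lt hq1)).deriv

/-! ### Compactness of `𝓑` and transversality -/

theorem exists_abs_le_of_finset (D : Finset ℝ) :
    ∃ M : ℝ, ∀ a ∈ D, |a| ≤ M := by
  obtain ⟨M, hM⟩ := (D.image abs).bddAbove
  exact ⟨M, fun a ha => hM (by simpa using ⟨a, ha, rfl⟩)⟩

theorem exists_abs_le_of_classB (D : Finset ℝ) :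
    ∃ M : ℝ, ∀ c ∈ classB D, ∀ i, |c i| ≤ M := by
  obtain ⟨M, hM⟩ := exists_abs_le_of_finset D
  refine ⟨M + M, fun c hc i => ?_⟩
  obtain ⟨a, ha, b, hb, h⟩ := hc.1 i
  rw [h]
  exact (abs_sub _ _).trans (add_le_add (hM a ha) (hM b hb))

/-- In the product topology this is Tychonoff for finite sets. The condition `c 0 ≠ 0` is closed
because coordinate 0 takes finitely many values. -/
theorem isCompact_classB (D : Finset ℝ) : IsCompact (classB D) := by
  set E : Set ℝ := {x | ∃ a ∈ D, ∃ b ∈ D, x = a - b} with hE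
  have hfin : E.Finite := by
    refine (Finset.finite_toSet (D.image₂ (· - ·) D)).subset ?_
    rintro x ⟨a, ha, b, hb, rfl⟩
    simpa using ⟨a, ha, b, hb, rfl⟩
  have h := isCompact_univ_pi (s := fun i : ℕ => if i = 0 then E \ {0} else E) fun i => by
    split_ifs
    · exact (hfin.subset sdiff_subset).isCompact
    · exact hfin.isCompact
  convert! h using 1
  ext c
  simp only [classB, mem_ofPred_eq, mem_univ_pi]
  constructor
  · rintro ⟨h1, h2⟩ i
    split_ifs with hi
    · subst hi
      exact ⟨h1 0, h2⟩
    · exact h1 i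
  · intro h
    refine ⟨fun i => ?_, ?_⟩
    · have := h i
      split_ifs at this
      · exact this.1
      · exact this
    · have := h 0
      simp only [if_true] at this
      exact this.2

/-- On the ball of radius `ε` about `x₀`, the power series with coefficients `c` is at least `δ` in
absolute value throughout, or its derivative is. -/
def IsTransversal (ε δ x₀ : ℝ) (c : ℕ → ℝ) : Prop :=
  (∀ x, dist x x₀ < ε → δ ≤ |powerSum c x|) ∨ (∀ x, dist x x₀ < ε → δ ≤ |deriv (powerSum c) x|)

theorem IsTransversal.mono {ε ε' δ δ' x₀ : ℝ} {c : ℕ → ℝ} (h : IsTransversal ε δ x₀ c)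
    (hε : ε' ≤ ε) (hδ : δ' ≤ δ) : IsTransversal ε' δ' x₀ c :=
  h.imp (fun h x hx => hδ.trans (h x (hx.trans_le hε)))
    (fun h x hx => hδ.trans (h x (hx.trans_le hε)))

theorem exists_le_abs_of_continuousWithinAt {A : Type*} [TopologicalSpace A] {S : Set A}
    {F : A × ℝ → ℝ} {a : A} {x₀ : ℝ} {T : Set ℝ} (hT : T ∈ 𝓝 x₀)
    (hF : ContinuousWithinAt F (S ×ˢ T) (a, x₀)) (h0 : F (a, x₀) ≠ 0) :
    ∃ ε > 0, ∃ δ > 0, ∀ᶠ b in 𝓝[S] a, ∀ x, dist x x₀ < ε → δ ≤ |F (b, x)| := by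
  have h1 : ∀ᶠ z in 𝓝[S ×ˢ T] (a, x₀), |F (a, x₀)| / 2 < |F z| :=
    hF.abs.eventually (lt_mem_nhds (half_lt_self (abs_pos.2 h0)))
  rw [nhdsWithin_prod_eq, nhdsWithin_eq_nhds.2 hT, eventually_prod_iff] at h1
  obtain ⟨pa, hpa, pb, hpb, h⟩ := h1
  obtain ⟨ε, hε, hb⟩ := Metric.eventually_nhds_iff.1 hpb
  exact ⟨ε, hε, _, half_pos (abs_pos.2 h0), hpa.mono fun b hpb x hx => (h hpb (hb hx)).le⟩

theorem exists_isTransversal_nhdsWithin {D : Finset ℝ} {c : ℕ → ℝ} (hc : c ∈ classB D) {x₀ : ℝ}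
    (hx₀ : x₀ ∈ Ioo (-1 : ℝ) 1) (h : ¬ IsDoubleRoot c x₀) :
    ∃ ε > 0, ∃ δ > 0, ∀ᶠ b in 𝓝[classB D] c, IsTransversal ε δ x₀ b := by
  obtain ⟨M, hM⟩ := exists_abs_le_of_classB D
  obtain ⟨q, hxq, hq1⟩ := exists_between (abs_lt.2 hx₀)
  have hq0 : 0 ≤ q := (abs_nonneg _).trans hxq.le
  have hT : {x : ℝ | |x| ≤ q} ∈ 𝓝 x₀ :=
    (continuous_abs.tendsto x₀).eventually (ge_mem_nhds hxq)
  have hsub : classB D ×ˢ {x : ℝ | |x| ≤ q} ⊆ {c | ∀ i, |c i| ≤ M} ×ˢ {x | |x| ≤ q} :=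
    prod_mono hM subset_rfl
  have hmem : (c, x₀) ∈ classB D ×ˢ {x : ℝ | |x| ≤ q} := ⟨hc, hxq.le⟩
  by_cases h1 : powerSum c x₀ = 0
  · have h2 : deriv (powerSum c) x₀ ≠ 0 := fun h2 => h ⟨hx₀, h1, h2⟩
    obtain ⟨ε, hε, δ, hδ, hb⟩ := exists_le_abs_of_continuousWithinAt hT
      (((continuousOn_deriv_powerSum M hq0 hq1).mono hsub) _ hmem) h2
    exact ⟨ε, hε, δ, hδ, hb.mono fun b hb => Or.inr hb⟩
  · obtain ⟨ε, hε, δ, hδ, hb⟩ := exists_le_abs_of_continuousWithinAt hT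
      (((continuousOn_powerSum M hq0 hq1).mono hsub) _ hmem) h1
    exact ⟨ε, hε, δ, hδ, hb.mono fun b hb => Or.inl hb⟩

/-- Transversality with fixed constants persists under small changes of the coefficients, so
compactness of `𝓑` makes the constants uniform. `Q` will be `x₀ ∈ I`: the second alternative is
useful only when the `L²` norms can be integrated near `x₀`. -/
theorem exists_uniform_isTransversal {D : Finset ℝ} {x₀ y₀ : ℝ} (hx₀ : x₀ ∈ Ioo (-1 : ℝ) 1)
    (hy₀ : y₀ ∈ Ioo (-1 : ℝ) 1) {Q : Prop}
    (h : ∀ c ∈ classB D, ¬ IsDoubleRoot c x₀ ∨ (Q ∧ ¬ IsDoubleRoot c y₀)) :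
    ∃ ε > 0, ∃ δ > 0, ∀ c ∈ classB D,
      IsTransversal ε δ x₀ c ∨ (Q ∧ IsTransversal ε δ y₀ c) := by
  refine (isCompact_classB D).induction_on (p := fun S => ∃ ε > 0, ∃ δ > 0, ∀ c ∈ S,
      IsTransversal ε δ x₀ c ∨ (Q ∧ IsTransversal ε δ y₀ c)) ?_ ?_ ?_ ?_
  · exact ⟨1, one_pos, 1, one_pos, by simp⟩
  · rintro s t hst ⟨ε, hε, δ, hδ, h⟩
    exact ⟨ε, hε, δ, hδ, fun c hc => h c (hst hc)⟩
  · rintro s t ⟨ε, hε, δ, hδ, h⟩ ⟨ε', hε', δ', hδ', h'⟩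
    refine ⟨min ε ε', lt_min hε hε', min δ δ', lt_min hδ hδ', fun c hc => ?_⟩
    rcases hc with hc | hc
    · exact (h c hc).imp (fun h => h.mono (min_le_left _ _) (min_le_left _ _))
        (fun h => ⟨h.1, h.2.mono (min_le_left _ _) (min_le_left _ _)⟩)
    · exact (h' c hc).imp (fun h => h.mono (min_le_right _ _) (min_le_right _ _))
        (fun h => ⟨h.1, h.2.mono (min_le_right _ _) (min_le_right _ _)⟩)
  · intro c hc
    rcases h c hc with h1 | ⟨hQ, h1⟩
    · obtain ⟨ε, hε, δ, hδ, hb⟩ := exists_isTransversal_nhdsWithin hc hx₀ h1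
      exact ⟨_, hb, ε, hε, δ, hδ, fun b hb => Or.inl hb⟩
    · obtain ⟨ε, hε, δ, hδ, hb⟩ := exists_isTransversal_nhdsWithin hc hy₀ h1
      exact ⟨_, hb, ε, hε, δ, hδ, fun b hb => Or.inr ⟨hQ, hb⟩⟩

theorem mul_dist_le_of_le_abs_deriv {f : ℝ → ℝ} {S : Set ℝ} (hS : S.OrdConnected)
    (hf : ∀ x ∈ S, DifferentiableAt ℝ f x) {δ : ℝ} (hδ : ∀ x ∈ S, δ ≤ |deriv f x|) {x y : ℝ}
    (hx : x ∈ S) (hy : y ∈ S) : δ * dist x y ≤ dist (f x) (f y) := by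
  wlog hxy : x < y generalizing x y
  · rcases eq_or_lt_of_le (not_lt.1 hxy) with h | h
    · simp [h]
    · rw [dist_comm x, dist_comm (f x)]
      exact this hy hx h
  have hsub : Icc x y ⊆ S := hS.out hx hy
  obtain ⟨z, hz, h⟩ := exists_deriv_eq_slope f hxy
    (fun z hz => (hf z (hsub hz)).continuousAt.continuousWithinAt)
    (fun z hz => (hf z (hsub (Ioo_subset_Icc_self hz))).differentiableWithinAt)
  have h1 := hδ z (hsub (Ioo_subset_Icc_self hz))
  rw [h, abs_div, abs_of_pos (sub_pos.2 hxy), le_div_iff₀ (sub_pos.2 hxy)] at h1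
  rw [dist_comm x, dist_comm (f x), Real.dist_eq, Real.dist_eq, abs_of_pos (sub_pos.2 hxy)]
  exact h1

theorem IsTransversal.volume_le {ε δ x₀ M r : ℝ} {c : ℕ → ℝ} (h : IsTransversal ε δ x₀ c)
    (hε : 0 < ε) (hδ : 0 < δ) (hc : ∀ i, |c i| ≤ M) (hball : Metric.ball x₀ ε ⊆ Ioo (0 : ℝ) 1)
    (hr : 0 < r) :
    volume (Metric.ball x₀ ε ∩ {x | |powerSum c x| ≤ r}) ≤
      ENNReal.ofReal (2 * (ε + 1) / δ) * ENNReal.ofReal r := by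
  rw [← ENNReal.ofReal_mul (by positivity)]
  -- For `r ≥ δ` the whole ball, of length `2ε ≤ 2εr/δ`, is small enough. For `r < δ` either the set
  -- is empty or its diameter is at most `2r/δ`. The constant `2(ε+1)/δ` covers all cases.
  rcases le_or_gt δ r with hr' | hr'
  · refine (measure_mono inter_subset_left).trans ?_
    rw [Real.volume_ball]
    refine ENNReal.ofReal_le_ofReal ?_
    rw [div_mul_eq_mul_div, le_div_iff₀ hδ]
    nlinarith [mul_le_mul_of_nonneg_left hr' hε.le]
  rcases h with h | h
  · have : Metric.ball x₀ ε ∩ {x | |powerSum c x| ≤ r} = ∅ := by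
      ext x
      simp only [mem_inter_iff, mem_ofPred_eq, mem_empty_iff_false, iff_false, not_and, not_le]
      exact fun hx => hr'.trans_le (h x hx)
    simp [this]
  · refine (Real.volume_le_diam _).trans (Metric.ediam_le fun x hx y hy => ?_)
    rw [edist_dist]
    refine ENNReal.ofReal_le_ofReal ?_
    have hS : (Metric.ball x₀ ε).OrdConnected := by
      rw [Real.ball_eq_Ioo]
      exact ordConnected_Ioo
    have h1 := mul_dist_le_of_le_abs_deriv hS (f := powerSum c) (fun z hz => by
        have := hball hz
        exact (hasDerivAt_powerSum hc (by
          rw [abs_of_pos this.1]; exact this.2)).differentiableAt) h hx.1 hy.1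
    have h2 : dist (powerSum c x) (powerSum c y) ≤ 2 * r := by
      rw [Real.dist_eq]
      refine (abs_sub _ _).trans ?_
      linarith [hx.2.out, hy.2.out]
    rw [div_mul_eq_mul_div, le_div_iff₀ hδ]
    nlinarith [mul_pos hε hr]

/-! ### Agreement of independent sequences -/

section Shift

variable {A : Type*}

/-- The sequence with first term `z.1`, followed by `z.2`. -/
def seqCons (z : A × (ℕ → A)) : ℕ → A := fun i => Nat.casesOn i z.1 z.2

@[simp] theorem seqCons_zero (z : A × (ℕ → A)) : seqCons z 0 = z.1 := rfl

@[simp] theorem seqCons_succ (z : A × (ℕ → A)) (i : ℕ) : seqCons z (i + 1) = z.2 i := rfl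

/-- The sequence pair obtained by deleting the first `k` terms of both sequences. -/
def shift (k : ℕ) (w : (ℕ → A) × (ℕ → A)) : (ℕ → A) × (ℕ → A) :=
  (fun i => w.1 (i + k), fun i => w.2 (i + k))

theorem measurable_seqCons [MeasurableSpace A] :
    Measurable (seqCons : A × (ℕ → A) → ℕ → A) := by
  refine measurable_pi_iff.2 fun i => ?_
  cases i with
  | zero => exact measurable_fst
  | succ i => exact (measurable_pi_apply i).comp measurable_snd

theorem measurable_shift [MeasurableSpace A] (k : ℕ) :
    Measurable (shift k : (ℕ → A) × (ℕ → A) → (ℕ → A) × (ℕ → A)) := by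
  unfold shift
  fun_prop

theorem map_seqCons_infinitePi [MeasurableSpace A] (p : Measure A) [IsProbabilityMeasure p] :
    (p.prod (Measure.infinitePi fun _ : ℕ => p)).map seqCons =
      Measure.infinitePi fun _ : ℕ => p := by
  classical
  refine Measure.eq_infinitePi _ fun s t ht => ?_
  obtain ⟨N, hN⟩ := s.exists_nat_subset_range
  have hN : s ⊆ Finset.range (N + 1) := hN.trans (Finset.range_subset_range.2 N.le_succ)
  -- Padding with the whole space makes the constraint range over an initial segment, from which
  -- coordinate 0 splits off.
  set u : ℕ → Set A := fun i => if i ∈ s then t i else univ with hu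
  have hum : ∀ i, MeasurableSet (u i) := fun i => by
    simp only [hu]
    split_ifs
    exacts [ht i, MeasurableSet.univ]
  have hset : seqCons ⁻¹' ((s : Set ℕ).pi t) =
      u 0 ×ˢ ((Finset.range N : Set ℕ).pi fun i => u (i + 1)) := by
    ext z
    simp only [mem_preimage, Set.mem_pi, Finset.mem_coe, mem_prod, hu, Finset.mem_range]
    constructor
    · refine fun h => ⟨?_, fun i _ => ?_⟩
      · split_ifs with h0
        exacts [h 0 h0, mem_univ _]
      · split_ifs with h0
        exacts [h (i + 1) h0, mem_univ _]
    · rintro ⟨h0, h⟩ i hi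
      cases i with
      | zero => rwa [if_pos hi] at h0
      | succ i =>
        have h1 := h i (by simpa using hN hi)
        rwa [if_pos hi] at h1
  rw [Measure.map_apply measurable_seqCons
    (MeasurableSet.pi s.countable_toSet fun i _ => ht i), hset, Measure.prod_prod,
    Measure.infinitePi_pi _ fun i _ => hum _, mul_comm, ← Finset.prod_range_succ' (fun i => p (u i))]
  rw [← Finset.prod_subset hN]
  · exact Finset.prod_congr rfl fun i hi => by simp [hu, hi]
  · intro i _ hi
    simp [hu, hi]

/-- The probability that two independent `p`-distributed points coincide. -/
noncomputable def collisionProb [MeasurableSpace A] (p : Measure A) : ℝ≥0∞ := ∫⁻ a, p {a} ∂p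

theorem collisionProb_le_one [MeasurableSpace A] (p : Measure A) [IsProbabilityMeasure p] :
    collisionProb p ≤ 1 :=
  (lintegral_mono fun _ => prob_le_one).trans (by simp)

variable [MeasurableSpace A] [Countable A] [MeasurableSingletonClass A]

theorem measurableSet_agree (k : ℕ) :
    MeasurableSet {w : (ℕ → A) × (ℕ → A) | ∀ i < k, w.1 i = w.2 i} := by
  have : {w : (ℕ → A) × (ℕ → A) | ∀ i < k, w.1 i = w.2 i} =
      ⋂ i, ⋂ (_ : i < k), {w | w.1 i = w.2 i} := by
    ext w
    simp
  rw [this]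
  exact MeasurableSet.iInter fun i => MeasurableSet.iInter fun _ =>
    measurableSet_eq_fun (by fun_prop) (by fun_prop)

theorem measurableSet_agree_inter (k : ℕ) {S : Set ((ℕ → A) × (ℕ → A))} (hS : MeasurableSet S) :
    MeasurableSet {w : (ℕ → A) × (ℕ → A) | (∀ i < k, w.1 i = w.2 i) ∧ shift k w ∈ S} :=
  (measurableSet_agree k).inter (measurable_shift k hS)

theorem prod_agree_one_inter (p : Measure A) [IsProbabilityMeasure p]
    {S : Set ((ℕ → A) × (ℕ → A))} (hS : MeasurableSet S) :
    ((Measure.infinitePi fun _ : ℕ => p).prod (Measure.infinitePi fun _ : ℕ => p))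
      {w | w.1 0 = w.2 0 ∧ shift 1 w ∈ S} = collisionProb p *
    ((Measure.infinitePi fun _ : ℕ => p).prod (Measure.infinitePi fun _ : ℕ => p)) S := by
  set ρ := Measure.infinitePi fun _ : ℕ => p with hρ
  have hm : MeasurableSet {w : (ℕ → A) × (ℕ → A) | w.1 0 = w.2 0 ∧ shift 1 w ∈ S} :=
    (measurableSet_eq_fun (by fun_prop) (by fun_prop)).inter (measurable_shift 1 hS)
  have hm' := (measurable_seqCons.prodMap measurable_seqCons) hm
  conv_lhs => rw [hρ, ← map_seqCons_infinitePi p,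
    Measure.map_prod_map _ _ measurable_seqCons measurable_seqCons,
    Measure.map_apply (measurable_seqCons.prodMap measurable_seqCons) hm,
    Measure.prod_apply hm', ← hρ]
  rw [Measure.prod_apply hS, collisionProb]
  rw [← lintegral_prod_mul (measurable_of_countable _).aemeasurable (measurable_measure_prodMk_left hS).aemeasurable]
  refine lintegral_congr fun u => ?_
  rw [← Measure.prod_prod]
  congr 1
  ext v
  simp [shift, Prod.map, eq_comm]

/-- Digits are independent and identically distributed, so agreement on the first `k` digits is
independent of the tails, whose joint law is unchanged. Induction removes one digit at a time. -/
theorem prod_agree_inter (p : Measure A) [IsProbabilityMeasure p] (k : ℕ)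
    {S : Set ((ℕ → A) × (ℕ → A))} (hS : MeasurableSet S) :
    ((Measure.infinitePi fun _ : ℕ => p).prod (Measure.infinitePi fun _ : ℕ => p))
      {w | (∀ i < k, w.1 i = w.2 i) ∧ shift k w ∈ S} = collisionProb p ^ k *
    ((Measure.infinitePi fun _ : ℕ => p).prod (Measure.infinitePi fun _ : ℕ => p)) S := by
  induction k with
  | zero => simp [shift]
  | succ k ih =>
    rw [pow_succ', mul_assoc, ← ih, ← prod_agree_one_inter p (measurableSet_agree_inter k hS)]
    congr 1
    ext w
    simp only [mem_ofPred_eq, Nat.forall_lt_succ_left', shift, and_assoc]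
    rfl

theorem prod_ne_zero_coord (p : Measure A) [IsProbabilityMeasure p] :
    ((Measure.infinitePi fun _ : ℕ => p).prod (Measure.infinitePi fun _ : ℕ => p))
      {w | w.1 0 ≠ w.2 0} = 1 - collisionProb p := by
  have h := prod_agree_one_inter p (S := univ) MeasurableSet.univ
  have hm : MeasurableSet {w : (ℕ → A) × (ℕ → A) | w.1 0 = w.2 0} :=
    measurableSet_eq_fun (by fun_prop) (by fun_prop)
  simp only [mem_univ, and_true, measure_univ, mul_one] at h
  rw [← h, ← prob_compl_eq_one_sub hm]
  rfl

theorem measurableSet_ne_zero_coord :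
    MeasurableSet {w : (ℕ → A) × (ℕ → A) | w.1 0 ≠ w.2 0} :=
  (measurableSet_eq_fun (by fun_prop) (by fun_prop)).compl

theorem prod_firstDisagree (p : Measure A) [IsProbabilityMeasure p] (k : ℕ) :
    ((Measure.infinitePi fun _ : ℕ => p).prod (Measure.infinitePi fun _ : ℕ => p))
      {w | (∀ i < k, w.1 i = w.2 i) ∧ w.1 k ≠ w.2 k} =
    collisionProb p ^ k * (1 - collisionProb p) := by
  rw [← prod_ne_zero_coord, ← prod_agree_inter p k measurableSet_ne_zero_coord]
  simp [shift]

theorem prod_diagonal_eq_zero (p : Measure A) [IsProbabilityMeasure p]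
    (hp : collisionProb p < 1) :
    ((Measure.infinitePi fun _ : ℕ => p).prod (Measure.infinitePi fun _ : ℕ => p))
      {w | w.1 = w.2} = 0 := by
  refine le_antisymm (ge_of_tendsto' (ENNReal.tendsto_pow_atTop_nhds_zero_of_lt_one hp)
    fun k => ?_) bot_le
  have h := prod_agree_inter p k (S := univ) MeasurableSet.univ
  rw [measure_univ, mul_one] at h
  rw [← h]
  refine measure_mono fun w hw => ⟨fun i _ => ?_, mem_univ _⟩
  rw [show w.1 = w.2 from hw]

end Shift

/-! ### The threshold as a collision probability -/

theorem threshold_bernoulliMeasure {D : Finset ℝ} (hD : 1 < D.card) (p : ProbabilityMeasure ↥D)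
    (h0 : collisionProb (p : Measure ↥D) ≠ 0) (h1 : collisionProb (p : Measure ↥D) < 1) :
    threshold D (bernoulliMeasure D p) = (collisionProb (p : Measure ↥D)).toReal := by
  set q := collisionProb (p : Measure ↥D) with hq
  set a := q.toReal with ha
  have hqa : q = ENNReal.ofReal a := (ENNReal.ofReal_toReal h1.ne_top).symm
  have ha0 : 0 < a := ENNReal.toReal_pos h0 h1.ne_top
  have ha1 : a < 1 := by
    rw [hqa] at h1
    simpa using h1
  have hlog : 0 < Real.log D.card := Real.log_pos (by exact_mod_cast hD)
  have hdim : corrDim D (bernoulliMeasure D p) =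
      ((-Real.log a / Real.log D.card : ℝ) : EReal) := by
    -- The probability is `a ^ k * (1 - a)`; after division by `k log m` the factor `1 - a` has no
    -- effect in the limit.
    have hlim : Tendsto (fun k : ℕ => -Real.log a / Real.log D.card -
        Real.log (1 - a) / Real.log D.card * (1 / (k : ℝ))) atTop
        (𝓝 (-Real.log a / Real.log D.card)) := by
      simpa using tendsto_const_nhds.sub
        ((tendsto_one_div_atTop_nhds_zero_nat (𝕜 := ℝ)).const_mul
          (Real.log (1 - a) / Real.log D.card))
    have hlim' := (continuous_coe_real_ereal.tendsto _).comp hlim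
    refine Tendsto.liminf_eq (hlim'.congr' ?_)
    filter_upwards [eventually_gt_atTop 0] with k hk
    have hk' : (0 : ℝ) < k := by exact_mod_cast hk
    have hP : ((bernoulliMeasure D p).prod (bernoulliMeasure D p))
        {w | (∀ i < k, w.1 i = w.2 i) ∧ w.1 k ≠ w.2 k} = ENNReal.ofReal (a ^ k * (1 - a)) := by
      rw [bernoulliMeasure, prod_firstDisagree, ← hq, hqa, ENNReal.ofReal_mul (by positivity),
        ENNReal.ofReal_pow ha0.le, ENNReal.ofReal_sub _ ha0.le, ENNReal.ofReal_one]
    rw [hP, ENNReal.log_ofReal_of_pos (mul_pos (pow_pos ha0 k) (sub_pos.2 ha1)),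
      ← EReal.coe_neg, ← EReal.coe_div, Function.comp,
      Real.log_mul (pow_pos ha0 k).ne' (sub_pos.2 ha1).ne', Real.log_pow]
    congr 1
    field_simp
    ring
  rw [threshold, hdim, ← EReal.coe_mul, ← EReal.coe_neg, EReal.exp_coe,
    div_mul_cancel₀ _ hlog.ne', neg_neg, Real.exp_log ha0, ENNReal.toReal_ofReal ha0.le]

/-! ### Close pairs and the energy estimate -/

variable {D : Finset ℝ}

/-- The difference of two sequences of digits. -/
def digitDiff (w : Seq D × Seq D) (i : ℕ) : ℝ := w.1 i - w.2 i

theorem exists_abs_digitDiff_le (D : Finset ℝ) :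
    ∃ M : ℝ, ∀ (w : Seq D × Seq D) (i : ℕ), |digitDiff w i| ≤ M := by
  obtain ⟨M, hM⟩ := exists_abs_le_of_finset D
  exact ⟨M + M, fun w i => (abs_sub _ _).trans (add_le_add (hM _ (w.1 i).2) (hM _ (w.2 i).2))⟩

theorem digitDiff_mem_classB {w : Seq D × Seq D} (h : w.1 0 ≠ w.2 0) : digitDiff w ∈ classB D :=
  ⟨fun i => ⟨_, (w.1 i).2, _, (w.2 i).2, rfl⟩, fun h0 => h (Subtype.ext (sub_eq_zero.1 h0))⟩

theorem dist_proj (w : Seq D × Seq D) {x : ℝ} (hx : |x| < 1) :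
    dist (proj D x w.1) (proj D x w.2) = |powerSum (digitDiff w) x| := by
  obtain ⟨M, hM⟩ := exists_abs_le_of_finset D
  rw [Real.dist_eq, proj, proj, powerSum, powerSum, powerSum,
    ← (summable_powerSum (fun i => hM _ (w.1 i).2) hx).tsum_sub
      (summable_powerSum (fun i => hM _ (w.2 i).2) hx)]
  simp only [digitDiff, sub_mul]

theorem powerSum_digitDiff_shift {w : Seq D × Seq D} {k : ℕ} (h : ∀ i < k, w.1 i = w.2 i)
    {x : ℝ} (hx : |x| < 1) :
    powerSum (digitDiff w) x = x ^ k * powerSum (digitDiff (shift k w)) x := by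
  obtain ⟨M, hM⟩ := exists_abs_digitDiff_le D
  rw [powerSum, powerSum, ← (summable_powerSum (hM w) hx).sum_add_tsum_nat_add k,
    Finset.sum_eq_zero fun i hi => by simp [digitDiff, h i (Finset.mem_range.1 hi)], zero_add,
    ← tsum_mul_left]
  refine tsum_congr fun i => ?_
  simp only [digitDiff, shift, pow_add]
  ring

theorem measurable_proj (x : ℝ) : Measurable (proj D x) := by
  unfold proj powerSum
  exact Measurable.tsum fun i =>
    (measurable_subtype_coe.comp (measurable_pi_apply i)).mul_const _

theorem measurable_proj₂ (x y : ℝ) : Measurable (proj₂ D x y) :=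
  (measurable_proj x).prodMk (measurable_proj y)

theorem measurable_powerSum_digitDiff :
    Measurable fun z : (Seq D × Seq D) × ℝ => powerSum (digitDiff z.1) z.2 := by
  unfold powerSum digitDiff
  refine Measurable.tsum fun i => ?_
  fun_prop

/-- The pairs of sequences whose projections are close to each other in both coordinates. -/
def closePairs (D : Finset ℝ) (z : ℝ × ℝ) (s t : ℝ) : Set (Seq D × Seq D) :=
  {w | |powerSum (digitDiff w) z.1| ≤ s ∧ |powerSum (digitDiff w) z.2| ≤ t}

theorem measurableSet_closePairs_prod (s t : ℝ) :
    MeasurableSet {v : (ℝ × ℝ) × (Seq D × Seq D) | v.2 ∈ closePairs D v.1 s t} := by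
  have h1 : Measurable fun v : (ℝ × ℝ) × (Seq D × Seq D) => powerSum (digitDiff v.2) v.1.1 :=
    measurable_powerSum_digitDiff.comp (measurable_snd.prodMk (measurable_fst.comp measurable_fst))
  have h2 : Measurable fun v : (ℝ × ℝ) × (Seq D × Seq D) => powerSum (digitDiff v.2) v.1.2 :=
    measurable_powerSum_digitDiff.comp (measurable_snd.prodMk (measurable_snd.comp measurable_fst))
  exact (measurableSet_le h1.abs measurable_const).inter
    (measurableSet_le h2.abs measurable_const)

theorem measurableSet_closePairs (z : ℝ × ℝ) (s t : ℝ) : MeasurableSet (closePairs D z s t) :=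
  measurable_prodMk_left (measurableSet_closePairs_prod s t)

/-- The measure of the set of parameters in `U` for which the projections of the two sequences are
close. -/
noncomputable def closeVolume (U : Set ℝ) (s : ℝ) (w : Seq D × Seq D) : ℝ≥0∞ :=
  volume (U ∩ {x | |powerSum (digitDiff w) x| ≤ s})

theorem closeVolume_eq (U : Set ℝ) (s : ℝ) (w : Seq D × Seq D) :
    closeVolume U s w = volume.restrict U {x | |powerSum (digitDiff w) x| ≤ s} := by
  rw [closeVolume, Measure.restrict_apply, inter_comm]
  exact measurableSet_le
    (measurable_powerSum_digitDiff.comp measurable_prodMk_left).abs measurable_const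

theorem measurableSet_close (s : ℝ) :
    MeasurableSet {v : (Seq D × Seq D) × ℝ | |powerSum (digitDiff v.1) v.2| ≤ s} :=
  measurableSet_le measurable_powerSum_digitDiff.abs measurable_const

theorem measurable_closeVolume (U : Set ℝ) (s : ℝ) :
    Measurable (closeVolume U s : Seq D × Seq D → ℝ≥0∞) := by
  simp only [funext (closeVolume_eq (D := D) U s)]
  exact measurable_measure_prodMk_left (measurableSet_close s)

theorem prod_close_le_sqNormDensity (ρ : Measure (Seq D)) [IsFiniteMeasure ρ] {x s : ℝ}
    (hx : |x| < 1) (hs : 0 < s) :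
    (ρ.prod ρ) {w | |powerSum (digitDiff w) x| ≤ s} ≤
      4 * ENNReal.ofReal s * sqNormDensity (nu D ρ x) := by
  have : IsFiniteMeasure (nu D ρ x) := by
    unfold nu
    infer_instance
  refine le_trans (le_of_eq ?_) (prod_dist_le_le_sqNormDensity (nu D ρ x) hs)
  rw [nu, Measure.map_prod_map _ _ (measurable_proj x) (measurable_proj x),
    Measure.map_apply ((measurable_proj x).prodMap (measurable_proj x))
      (measurableSet_le (measurable_fst.dist measurable_snd) measurable_const)]
  congr 1
  ext w
  simp [Prod.map, dist_proj w hx]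

theorem lintegral_closeVolume_le (ρ : Measure (Seq D)) [IsFiniteMeasure ρ] {U : Set ℝ}
    (hUm : MeasurableSet U) (hU : U ⊆ Ioo 0 1) {s : ℝ} (hs : 0 < s) :
    ∫⁻ w, closeVolume U s w ∂(ρ.prod ρ) ≤
      4 * ENNReal.ofReal s * ∫⁻ x in U, sqNormDensity (nu D ρ x) := by
  have h1 : ∫⁻ w, closeVolume U s w ∂(ρ.prod ρ) =
      ∫⁻ x in U, (ρ.prod ρ) {w | |powerSum (digitDiff w) x| ≤ s} := by
    simp only [closeVolume_eq]
    exact (Measure.prod_apply (measurableSet_close s)).symm.trans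
      (Measure.prod_apply_symm (measurableSet_close s))
  rw [h1, ← lintegral_const_mul' _ _ (by finiteness)]
  refine setLIntegral_mono' hUm fun x hx => prod_close_le_sqNormDensity ρ ?_ hs
  rw [abs_of_pos (hU hx).1]
  exact (hU hx).2

theorem lintegral_prod_inter_closePairs (P : Measure (Seq D × Seq D)) [IsFiniteMeasure P]
    (U V : Set ℝ) (s t : ℝ) (E : Set (Seq D × Seq D)) :
    ∫⁻ z in U ×ˢ V, P (E ∩ closePairs D z s t) =
      ∫⁻ w in E, closeVolume U s w * closeVolume V t w ∂P := by
  have h1 : ∀ z, P (E ∩ closePairs D z s t) = P.restrict E (closePairs D z s t) := fun z => by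
    rw [Measure.restrict_apply (measurableSet_closePairs z s t), inter_comm]
  have h2 := measurableSet_closePairs_prod (D := D) s t
  simp only [h1]
  refine (Measure.prod_apply h2).symm.trans ((Measure.prod_apply_symm h2).trans ?_)
  refine lintegral_congr fun w => ?_
  rw [closeVolume_eq, closeVolume_eq, Measure.volume_eq_prod, ← Measure.prod_restrict,
    ← Measure.prod_prod]
  rfl

/-- The hypothesis `h` encodes transversality in either variable: one length is replaced by its
uniform bound and the other survives to be averaged over pairs, which costs an integrated `L²` norm.
-/
theorem lintegral_firstDisagree_closePairs_le (p : ProbabilityMeasure ↥D) {U V : Set ℝ}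
    (hU : U ⊆ Ioo 0 1) (hV : V ⊆ Ioo 0 1) (hUm : MeasurableSet U) (hVm : MeasurableSet V)
    {a b : ℝ≥0∞} {s t : ℝ} (hs : 0 < s) (ht : 0 < t)
    (h : ∀ w : Seq D × Seq D, w.1 0 ≠ w.2 0 → closeVolume U s w * closeVolume V t w ≤
      a * ENNReal.ofReal s * closeVolume V t w + b * ENNReal.ofReal t * closeVolume U s w) :
    ∫⁻ z in U ×ˢ V, ((bernoulliMeasure D p).prod (bernoulliMeasure D p))
        ({w | w.1 0 ≠ w.2 0} ∩ closePairs D z s t) ≤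
      4 * (a * (∫⁻ x in V, sqNormDensity (nu D (bernoulliMeasure D p) x)) +
        b * (∫⁻ x in U, sqNormDensity (nu D (bernoulliMeasure D p) x))) *
        (ENNReal.ofReal s * ENNReal.ofReal t) := by
  set ρ := bernoulliMeasure D p
  rw [lintegral_prod_inter_closePairs]
  calc _ ≤ ∫⁻ w in {w | w.1 0 ≠ w.2 0}, a * ENNReal.ofReal s * closeVolume V t w +
          b * ENNReal.ofReal t * closeVolume U s w ∂(ρ.prod ρ) :=
        setLIntegral_mono' measurableSet_ne_zero_coord h
    _ ≤ ∫⁻ w, a * ENNReal.ofReal s * closeVolume V t w +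
          b * ENNReal.ofReal t * closeVolume U s w ∂(ρ.prod ρ) := setLIntegral_le_lintegral _ _
    _ = a * ENNReal.ofReal s * (∫⁻ w, closeVolume V t w ∂(ρ.prod ρ)) +
          b * ENNReal.ofReal t * ∫⁻ w, closeVolume U s w ∂(ρ.prod ρ) := by
        rw [lintegral_add_left ((measurable_closeVolume V t).const_mul _),
          lintegral_const_mul _ (measurable_closeVolume V t),
          lintegral_const_mul _ (measurable_closeVolume U s)]
    _ ≤ a * ENNReal.ofReal s * (4 * ENNReal.ofReal t * ∫⁻ x in V, sqNormDensity (nu D ρ x)) +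
          b * ENNReal.ofReal t * (4 * ENNReal.ofReal s * ∫⁻ x in U, sqNormDensity (nu D ρ x)) := by
        gcongr
        · exact lintegral_closeVolume_le ρ hVm hV ht
        · exact lintegral_closeVolume_le ρ hUm hU hs
    _ = _ := by ring

theorem prod_closePairs_le_tsum (p : ProbabilityMeasure ↥D)
    (hp : collisionProb (p : Measure ↥D) < 1) {z : ℝ × ℝ} {a b r : ℝ} (ha : 0 < a) (hb : 0 < b)
    (hz1 : z.1 ∈ Ico a 1) (hz2 : z.2 ∈ Ico b 1) :
    ((bernoulliMeasure D p).prod (bernoulliMeasure D p)) (closePairs D z r r) ≤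
      ∑' k : ℕ, collisionProb (p : Measure ↥D) ^ k *
        ((bernoulliMeasure D p).prod (bernoulliMeasure D p))
          ({w | w.1 0 ≠ w.2 0} ∩ closePairs D z (r / a ^ k) (r / b ^ k)) := by
  classical
  have hdiag := prod_diagonal_eq_zero (p : Measure ↥D) hp
  set E : ℕ → Set (Seq D × Seq D) := fun k => {w | (∀ i < k, w.1 i = w.2 i) ∧
    shift k w ∈ {w | w.1 0 ≠ w.2 0} ∩ closePairs D z (r / a ^ k) (r / b ^ k)} with hE
  -- Off the null diagonal, a close pair is sorted by its first disagreement `k`. Dividing by `x ^ k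
  -- ≥ c ^ k` enlarges the tolerance to `r / c ^ k`.
  have hcover : closePairs D z r r ⊆ {w | w.1 = w.2} ∪ ⋃ k, E k := by
    intro w hw
    by_cases heq : w.1 = w.2
    · exact Or.inl heq
    right
    have hex : ∃ k, w.1 k ≠ w.2 k := Function.ne_iff.1 heq
    have hlt : ∀ i < Nat.find hex, w.1 i = w.2 i := fun i hi => not_not.1 (Nat.find_min hex hi)
    have hle : ∀ {x c : ℝ}, 0 < c → x ∈ Ico c 1 → |powerSum (digitDiff w) x| ≤ r →
        |powerSum (digitDiff (shift (Nat.find hex) w)) x| ≤ r / c ^ Nat.find hex := by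
      intro x c hc hx h
      have hx0 : 0 < x := hc.trans_le hx.1
      rw [powerSum_digitDiff_shift hlt (by rw [abs_of_pos hx0]; exact hx.2), abs_mul, abs_pow,
        abs_of_pos hx0] at h
      rw [le_div_iff₀ (pow_pos hc _), mul_comm]
      refine le_trans ?_ h
      gcongr
      exact hx.1
    refine mem_iUnion.2 ⟨Nat.find hex, hlt, ?_, hle ha hz1 hw.1, hle hb hz2 hw.2⟩
    simpa [shift] using Nat.find_spec hex
  refine (measure_mono hcover).trans ((measure_union_le _ _).trans ?_)
  rw [bernoulliMeasure, hdiag, zero_add]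
  refine (measure_iUnion_le _).trans (ENNReal.tsum_le_tsum fun k => ?_)
  exact (prod_agree_inter (p : Measure ↥D) k
    (measurableSet_ne_zero_coord.inter (measurableSet_closePairs z _ _))).le

theorem measurable_prod_closePairs (P : Measure (Seq D × Seq D)) [IsFiniteMeasure P]
    {E : Set (Seq D × Seq D)} (hE : MeasurableSet E) (s t : ℝ) :
    Measurable fun z => P (E ∩ closePairs D z s t) :=
  measurable_measure_prodMk_left
    ((measurable_snd hE).inter (measurableSet_closePairs_prod (D := D) s t))

/-- The energy estimate on a rectangle of parameters. -/
theorem lintegral_closePairs_le (p : ProbabilityMeasure ↥D)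
    (hp : collisionProb (p : Measure ↥D) < 1) {U V : Set ℝ} {u v : ℝ} (hu : 0 < u) (hv : 0 < v)
    (huv : collisionProb (p : Measure ↥D) < ENNReal.ofReal (u * v))
    (hU : U ⊆ Ico u 1) (hV : V ⊆ Ico v 1) (hUm : MeasurableSet U) (hVm : MeasurableSet V)
    {a b : ℝ≥0∞}
    (h : ∀ s > 0, ∀ t > 0, ∀ w : Seq D × Seq D, w.1 0 ≠ w.2 0 →
      closeVolume U s w * closeVolume V t w ≤
      a * ENNReal.ofReal s * closeVolume V t w + b * ENNReal.ofReal t * closeVolume U s w)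
    (hfin : a * (∫⁻ x in V, sqNormDensity (nu D (bernoulliMeasure D p) x)) +
        b * (∫⁻ x in U, sqNormDensity (nu D (bernoulliMeasure D p) x)) < ⊤) :
    ∃ K < ⊤, ∀ r > 0, ∫⁻ z in U ×ˢ V,
      ((bernoulliMeasure D p).prod (bernoulliMeasure D p)) (closePairs D z r r) ≤
        K * ENNReal.ofReal r ^ 2 := by
  set ρ := bernoulliMeasure D p
  set q := collisionProb (p : Measure ↥D)
  set C := 4 * (a * (∫⁻ x in V, sqNormDensity (nu D ρ x)) +
        b * (∫⁻ x in U, sqNormDensity (nu D ρ x))) with hC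
  have hCfin : C < ⊤ := ENNReal.mul_lt_top (by norm_num) hfin
  have huv0 : 0 < u * v := mul_pos hu hv
  have hq1 : q / ENNReal.ofReal (u * v) < 1 :=
    ENNReal.div_lt_of_lt_mul (by rwa [one_mul])
  have hsum : ∑' k : ℕ, (q / ENNReal.ofReal (u * v)) ^ k < ⊤ := by
    rw [ENNReal.tsum_geometric, ENNReal.inv_lt_top]
    exact tsub_pos_of_lt hq1
  refine ⟨(∑' k : ℕ, (q / ENNReal.ofReal (u * v)) ^ k) * C, ENNReal.mul_lt_top hsum hCfin,
    fun r hr => ?_⟩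
  have hm : ∀ k : ℕ, Measurable fun z => q ^ k * (ρ.prod ρ)
      ({w | w.1 0 ≠ w.2 0} ∩ closePairs D z (r / u ^ k) (r / v ^ k)) := fun k =>
    (measurable_prod_closePairs _ measurableSet_ne_zero_coord _ _).const_mul _
  calc ∫⁻ z in U ×ˢ V, (ρ.prod ρ) (closePairs D z r r)
      ≤ ∫⁻ z in U ×ˢ V, ∑' k : ℕ, q ^ k * (ρ.prod ρ)
          ({w | w.1 0 ≠ w.2 0} ∩ closePairs D z (r / u ^ k) (r / v ^ k)) :=
        setLIntegral_mono' (hUm.prod hVm) fun z hz =>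
          prod_closePairs_le_tsum p hp hu hv (hU hz.1) (hV hz.2)
    _ = ∑' k : ℕ, q ^ k * ∫⁻ z in U ×ˢ V, (ρ.prod ρ)
          ({w | w.1 0 ≠ w.2 0} ∩ closePairs D z (r / u ^ k) (r / v ^ k)) := by
        rw [lintegral_tsum fun k => (hm k).aemeasurable]
        exact tsum_congr fun k => lintegral_const_mul _
          (measurable_prod_closePairs _ measurableSet_ne_zero_coord _ _)
    _ ≤ ∑' k : ℕ, (q / ENNReal.ofReal (u * v)) ^ k * (C * ENNReal.ofReal r ^ 2) := by
        refine ENNReal.tsum_le_tsum fun k => ?_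
        have hs : 0 < r / u ^ k := by positivity
        have ht : 0 < r / v ^ k := by positivity
        refine (mul_le_mul_right (lintegral_firstDisagree_closePairs_le p
          (hU.trans fun x hx => ⟨hu.trans_le hx.1, hx.2⟩)
          (hV.trans fun x hx => ⟨hv.trans_le hx.1, hx.2⟩) hUm hVm hs ht (h _ hs _ ht)) _).trans
          (le_of_eq ?_)
        have h1 : ENNReal.ofReal (r / u ^ k) * ENNReal.ofReal (r / v ^ k) =
            ENNReal.ofReal r ^ 2 * ((ENNReal.ofReal (u * v)) ^ k)⁻¹ := by
          rw [← ENNReal.ofReal_mul hs.le, ← ENNReal.ofReal_pow hr.le, ← ENNReal.ofReal_pow huv0.le,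
            ← ENNReal.ofReal_inv_of_pos (by positivity), ← ENNReal.ofReal_mul (by positivity)]
          congr 1
          rw [mul_pow]
          field_simp
        rw [h1, div_eq_mul_inv, mul_pow, ENNReal.inv_pow]
        ring
    _ = _ := by
        rw [ENNReal.tsum_mul_right]
        ring

/-- Fatou along `r = 1 / (n + 1)` makes the liminf of the normalised correlation integrals finite
for almost every parameter pair. -/
theorem ae_hasL2Density_of_lintegral_closePairs_le (p : ProbabilityMeasure ↥D) {U V : Set ℝ}
    (hU : U ⊆ Ioo 0 1) (hV : V ⊆ Ioo 0 1) (hUm : MeasurableSet U) (hVm : MeasurableSet V)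
    {K : ℝ≥0∞} (hK : K < ⊤)
    (h : ∀ r > 0, ∫⁻ z in U ×ˢ V,
      ((bernoulliMeasure D p).prod (bernoulliMeasure D p)) (closePairs D z r r) ≤
        K * ENNReal.ofReal r ^ 2) :
    ∀ᵐ z : ℝ × ℝ, z ∈ U ×ˢ V → HasL2Density (mu D (bernoulliMeasure D p) z.1 z.2) := by
  set ρ := bernoulliMeasure D p
  set r : ℕ → ℝ := fun n => 1 / ((n : ℝ) + 1) with hr
  have hr0 : ∀ n, 0 < r n := fun n => Nat.one_div_pos_of_nat
  have hm : ∀ n, Measurable fun z => (ρ.prod ρ) (closePairs D z (r n) (r n)) /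
      ENNReal.ofReal (r n) ^ 2 := fun n => by
    have := measurable_prod_closePairs (ρ.prod ρ) MeasurableSet.univ (r n) (r n)
    simp only [univ_inter] at this
    exact this.div_const _
  have hint : ∫⁻ z in U ×ˢ V, liminf (fun n => (ρ.prod ρ) (closePairs D z (r n) (r n)) /
      ENNReal.ofReal (r n) ^ 2) atTop < ⊤ := by
    refine (lintegral_liminf_le hm).trans_lt (lt_of_le_of_lt ?_ hK)
    refine liminf_le_of_frequently_le' (Frequently.of_forall fun n => ?_)
    have hne : ENNReal.ofReal (r n) ^ 2 ≠ 0 := by simp [hr0 n]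
    simp only [div_eq_mul_inv]
    rw [lintegral_mul_const' _ _ (ENNReal.inv_ne_top.2 hne), ← div_eq_mul_inv]
    exact ENNReal.div_le_of_le_mul (h _ (hr0 n))
  have hae := ae_lt_top (Measurable.liminf hm) hint.ne
  rw [ae_restrict_iff' (hUm.prod hVm)] at hae
  filter_upwards [hae] with z hz hzUV
  have : IsFiniteMeasure (mu D ρ z.1 z.2) := by
    unfold mu
    infer_instance
  refine hasL2Density_of_liminf _ r hr0 tendsto_one_div_add_atTop_nhds_zero_nat ?_
  refine lt_of_le_of_lt (le_of_eq ?_) (hz hzUV)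
  congr 1
  ext n
  congr 1
  have hmz := measurable_proj₂ (D := D) z.1 z.2
  rw [mu, Measure.map_prod_map _ _ hmz hmz, Measure.map_apply (hmz.prodMap hmz)
      (measurableSet_le (measurable_fst.dist measurable_snd) measurable_const)]
  congr 1
  ext w
  have h1 := hU hzUV.1
  have h2 := hV hzUV.2
  simp [Prod.map, proj₂, Prod.dist_eq, closePairs,
    dist_proj w (x := z.1) (by rw [abs_of_pos h1.1]; exact h1.2),
    dist_proj w (x := z.2) (by rw [abs_of_pos h2.1]; exact h2.2)]

/-! ### Degenerate measures and the local theorem -/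

/-- Two independent sequences almost surely coincide, so pairs are close with probability 1 at every
scale `s`. A finite norm would force this probability to be `O(s)`. -/
theorem sqNormDensity_nu_eq_top (p : ProbabilityMeasure ↥D)
    (hp : collisionProb (p : Measure ↥D) = 1) {x : ℝ} (hx : |x| < 1) :
    sqNormDensity (nu D (bernoulliMeasure D p) x) = ⊤ := by
  set ρ := bernoulliMeasure D p
  have hdiag : ∀ᵐ w ∂(ρ.prod ρ), w.1 = w.2 := by
    have h : ∀ k, (ρ.prod ρ) {w | w.1 k ≠ w.2 k ∧ ∀ i < k, w.1 i = w.2 i} = 0 := fun k => by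
      have := prod_firstDisagree (p : Measure ↥D) k
      rw [hp, tsub_self, mul_zero] at this
      rw [← this]
      simp only [and_comm]
      rfl
    rw [ae_iff]
    refine measure_mono_null (fun w hw => ?_) (measure_iUnion_null h)
    classical
    have hex : ∃ k, w.1 k ≠ w.2 k := Function.ne_iff.1 hw
    exact mem_iUnion.2 ⟨Nat.find hex, Nat.find_spec hex,
      fun i hi => not_not.1 (Nat.find_min hex hi)⟩
  have hone : ∀ s > 0, (1 : ℝ≥0∞) ≤
      4 * ENNReal.ofReal s * sqNormDensity (nu D ρ x) := fun s hs => by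
    refine le_trans (le_of_eq ?_) (prod_close_le_sqNormDensity ρ hx hs)
    refine ((mem_ae_iff_prob_eq_one
      (measurable_prodMk_right (measurableSet_close (D := D) s))).1 ?_).symm
    filter_upwards [hdiag] with w hw
    simp [powerSum, digitDiff, hw, hs.le]
  by_contra hne
  have hlim : Tendsto (fun s : ℝ => 4 * ENNReal.ofReal s * sqNormDensity (nu D ρ x)) (𝓝[>] 0)
      (𝓝 (4 * ENNReal.ofReal 0 * sqNormDensity (nu D ρ x))) := by
    refine Tendsto.mono_left ?_ nhdsWithin_le_nhds
    refine ENNReal.Tendsto.mul_const ?_ (Or.inr hne)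
    refine ENNReal.Tendsto.const_mul (ENNReal.tendsto_ofReal tendsto_id) (Or.inr (by norm_num))
  have := ge_of_tendsto hlim (eventually_mem_nhdsWithin.mono hone)
  simp at this

theorem collisionProb_lt_one (p : ProbabilityMeasure ↥D) {I : Set ℝ} (hI : I ⊆ Ioo 0 1)
    (hI_open : IsOpen I) (hI_ne : I.Nonempty)
    (hI_norm : ∀ I' : Set ℝ, IsCompact (closure I') → closure I' ⊆ I →
      ∫⁻ l in I', sqNormDensity (nu D (bernoulliMeasure D p) l) < ⊤) :
    collisionProb (p : Measure ↥D) < 1 := by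
  refine lt_of_le_of_ne (collisionProb_le_one _) fun hp => ?_
  obtain ⟨x, hx⟩ := hI_ne
  obtain ⟨ε, hε, hball⟩ := Metric.nhds_basis_closedBall.mem_iff.1 (hI_open.mem_nhds hx)
  have hcl : closure (Metric.closedBall x ε) = Metric.closedBall x ε :=
    Metric.isClosed_closedBall.closure_eq
  have h := hI_norm (Metric.closedBall x ε) (by rw [hcl]; exact isCompact_closedBall x ε)
    (by rwa [hcl])
  have h2 : ∫⁻ l in Metric.closedBall x ε, sqNormDensity (nu D (bernoulliMeasure D p) l) =
      ∫⁻ _ in Metric.closedBall x ε, ⊤ := by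
    refine setLIntegral_congr_fun measurableSet_closedBall fun l hl => ?_
    have := hI (hball hl)
    exact sqNormDensity_nu_eq_top p hp (by rw [abs_of_pos this.1]; exact this.2)
  rw [h2, lintegral_const, ENNReal.top_mul] at h
  · exact lt_irrefl _ h
  · simpa using hε

theorem collisionProb_lt_of_threshold_lt (hD : 1 < D.card) (p : ProbabilityMeasure ↥D)
    (hp : collisionProb (p : Measure ↥D) < 1) {t : ℝ} (ht : 0 < t)
    (h : threshold D (bernoulliMeasure D p) < t) :
    collisionProb (p : Measure ↥D) < ENNReal.ofReal t := by
  -- The formula for the threshold needs `q ≠ 0`; for `q = 0` positivity of `t` suffices.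
  by_cases h0 : collisionProb (p : Measure ↥D) = 0
  · simpa [h0] using ht
  · rw [threshold_bernoulliMeasure hD p h0 hp] at h
    exact (ENNReal.lt_ofReal_iff_toReal_lt hp.ne_top).2 h

/-- The local form of the main theorem: near every admissible pair of parameters, almost every
pair gives a measure with square integrable density. -/
theorem exists_nhds_ae_hasL2Density (p : ProbabilityMeasure ↥D)
    (hp : collisionProb (p : Measure ↥D) < 1) {I : Set ℝ} (hI_open : IsOpen I)
    (hI_norm : ∀ I' : Set ℝ, IsCompact (closure I') → closure I' ⊆ I →
      ∫⁻ l in I', sqNormDensity (nu D (bernoulliMeasure D p) l) < ⊤)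
    {x₀ y₀ : ℝ} (hx₀ : x₀ ∈ Ioo (0 : ℝ) 1) (hy₀ : y₀ ∈ Ioo (0 : ℝ) 1) (hyI : y₀ ∈ I)
    (hpxy : collisionProb (p : Measure ↥D) < ENNReal.ofReal (x₀ * y₀))
    (h : ∀ c ∈ classB D, ¬ IsDoubleRoot c x₀ ∨ (x₀ ∈ I ∧ ¬ IsDoubleRoot c y₀)) :
    ∃ N ∈ 𝓝 (x₀, y₀), ∀ᵐ z : ℝ × ℝ,
      z ∈ N → HasL2Density (mu D (bernoulliMeasure D p) z.1 z.2) := by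
  classical
  have hneg : Ioo (0 : ℝ) 1 ⊆ Ioo (-1) 1 := Ioo_subset_Ioo_left (by norm_num)
  obtain ⟨ε₁, hε₁, δ, hδ, htrans⟩ := exists_uniform_isTransversal (hneg hx₀) (hneg hy₀) h
  obtain ⟨M, hM⟩ := exists_abs_digitDiff_le D
  -- Shrinking both parameters by `θ < 1` leaves room for a neighbourhood with lower bounds `u = θ
  -- x₀`, `v = θ y₀` whose product still exceeds `q`.
  obtain ⟨θ, hθ, hθ0, hθ1⟩ : ∃ θ : ℝ, collisionProb (p : Measure ↥D) <
      ENNReal.ofReal ((θ * x₀) * (θ * y₀)) ∧ 0 < θ ∧ θ < 1 := by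
    have hcont : Tendsto (fun θ : ℝ => ENNReal.ofReal ((θ * x₀) * (θ * y₀))) (𝓝[<] 1)
        (𝓝 (ENNReal.ofReal ((1 * x₀) * (1 * y₀)))) :=
      (ENNReal.continuous_ofReal.comp (by fun_prop :
        Continuous fun θ : ℝ => (θ * x₀) * (θ * y₀))).tendsto' _ _ rfl |>.mono_left
        nhdsWithin_le_nhds
    rw [one_mul, one_mul] at hcont
    obtain ⟨θ, h1, h2, h3⟩ := ((hcont.eventually (lt_mem_nhds hpxy)).and
      (Ioo_mem_nhdsLT zero_lt_one)).exists
    exact ⟨θ, h1, h2, h3⟩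
  have hIco : ∀ x ∈ Ioo (0 : ℝ) 1, Ico (θ * x) 1 ∈ 𝓝 x := fun x hx =>
    Ico_mem_nhds (by nlinarith [hx.1]) hx.2
  have hxset : (Ico (θ * x₀) 1 ∩ {x | x₀ ∈ I → x ∈ I}) ∈ 𝓝 x₀ := by
    refine inter_mem (hIco x₀ hx₀) ?_
    by_cases hxI : x₀ ∈ I
    · simpa [hxI] using hI_open.mem_nhds hxI
    · simp [hxI]
  obtain ⟨ε₂, hε₂, hx⟩ := Metric.nhds_basis_closedBall.mem_iff.1 hxset
  obtain ⟨ε₃, hε₃, hy⟩ := Metric.nhds_basis_closedBall.mem_iff.1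
    (inter_mem (hIco y₀ hy₀) (hI_open.mem_nhds hyI))
  set ε := min ε₁ (min ε₂ ε₃) with hεdef
  have hε : 0 < ε := lt_min hε₁ (lt_min hε₂ hε₃)
  have hεx : Metric.closedBall x₀ ε ⊆ Metric.closedBall x₀ ε₂ :=
    Metric.closedBall_subset_closedBall ((min_le_right _ _).trans (min_le_left _ _))
  have hεy : Metric.closedBall y₀ ε ⊆ Metric.closedBall y₀ ε₃ :=
    Metric.closedBall_subset_closedBall ((min_le_right _ _).trans (min_le_right _ _))
  have hU : Metric.ball x₀ ε ⊆ Ico (θ * x₀) 1 := fun x hxb =>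
    (hx (hεx (Metric.ball_subset_closedBall hxb))).1
  have hV : Metric.ball y₀ ε ⊆ Ico (θ * y₀) 1 := fun y hyb =>
    (hy (hεy (Metric.ball_subset_closedBall hyb))).1
  have hu : 0 < θ * x₀ := mul_pos hθ0 hx₀.1
  have hv : 0 < θ * y₀ := mul_pos hθ0 hy₀.1
  have hU' : Metric.ball x₀ ε ⊆ Ioo 0 1 := hU.trans fun x hx => ⟨hu.trans_le hx.1, hx.2⟩
  have hV' : Metric.ball y₀ ε ⊆ Ioo 0 1 := hV.trans fun x hx => ⟨hv.trans_le hx.1, hx.2⟩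
  have hnorm : ∀ x : ℝ, Metric.closedBall x ε ⊆ I →
      ∫⁻ l in Metric.ball x ε, sqNormDensity (nu D (bernoulliMeasure D p) l) < ⊤ := fun x hx =>
    hI_norm _ ((isCompact_closedBall x ε).of_isClosed_subset isClosed_closure
      Metric.closure_ball_subset_closedBall) (Metric.closure_ball_subset_closedBall.trans hx)
  set a : ℝ≥0∞ := ENNReal.ofReal (2 * (ε + 1) / δ) with ha
  -- If `x₀ ∉ I`, only transversality at `x₀` occurs. Taking `b = 0` then discards the possibly
  -- infinite integral over `U`, by `0 * ⊤ = 0`.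
  obtain ⟨K, hK, hle⟩ := lintegral_closePairs_le p hp hu hv hθ hU hV measurableSet_ball
    measurableSet_ball (a := a) (b := if x₀ ∈ I then a else 0) (fun s hs t ht w hw => by
      rcases htrans _ (digitDiff_mem_classB hw) with h1 | ⟨hxI, h1⟩
      · refine le_trans ?_ le_self_add
        gcongr
        exact (h1.mono (min_le_left _ _) le_rfl).volume_le hε hδ (hM w) hU' hs
      · refine le_trans ?_ le_add_self
        rw [if_pos hxI, mul_comm]
        gcongr
        exact (h1.mono (min_le_left _ _) le_rfl).volume_le hε hδ (hM w) hV' ht) (by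
      refine ENNReal.add_lt_top.2 ⟨ENNReal.mul_lt_top ENNReal.ofReal_lt_top
        (hnorm y₀ fun y hyb => (hy (hεy hyb)).2), ?_⟩
      split_ifs with hxI
      · exact ENNReal.mul_lt_top ENNReal.ofReal_lt_top
          (hnorm x₀ fun x hxb => (hx (hεx hxb)).2 hxI)
      · simp)
  exact ⟨_, prod_mem_nhds (Metric.ball_mem_nhds x₀ hε) (Metric.ball_mem_nhds y₀ hε),
    ae_hasL2Density_of_lintegral_closePairs_le p hU' hV' measurableSet_ball measurableSet_ball hK
      hle⟩

end SelfAffine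

/-! ### From the local to the global statement -/

theorem mainTheorem4
    (D : Finset ℝ) (hD : IsLeast (D : Set ℝ) 0)
    (p : ProbabilityMeasure ↥D)
    (I J : Set ℝ) (R : Set (ℝ × ℝ))
    (hI_open : IsOpen I) (hI_conn : I.OrdConnected) (hI : I ⊆ Ioo (1 / (D.card : ℝ)) 1)
    (hI_norm : ∀ I' : Set ℝ, IsCompact (closure I') → closure I' ⊆ I →
      ∫⁻ l in I', sqNormDensity (nu D (bernoulliMeasure D p) l) < ⊤)
    (hJ_open : IsOpen J) (hJ_conn : J.OrdConnected) (hJ : J ⊆ Ioo (1 / (D.card : ℝ)) 1)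
    (hJ_root : ∀ c ∈ classB D, ∀ x ∈ J, ¬ IsDoubleRoot c x)
    (hR_open : IsOpen R)
    (hR_root : ∀ z ∈ R, ∀ c ∈ classB D, ¬ (IsDoubleRoot c z.1 ∧ IsDoubleRoot c z.2)) :
    ∀ᵐ z : ℝ × ℝ,
      z ∈ (R ∩ I ×ˢ I ∩ Gam D.card (threshold D (bernoulliMeasure D p)) 1) ∪
          (J ×ˢ I ∩ Gam D.card (threshold D (bernoulliMeasure D p)) 1) →
        HasL2Density (mu D (bernoulliMeasure D p) z.1 z.2) := by
  have hcard0 : 0 < D.card := Finset.card_pos.2 ⟨0, hD.1⟩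
  have hI01 : I ⊆ Ioo 0 1 := hI.trans (Ioo_subset_Ioo_left (by positivity))
  rw [ae_iff]
  -- By the Lindelöf property it suffices that each exceptional pair has a neighbourhood in which
  -- the exceptional set is null.
  refine measure_null_of_locally_null _ fun z hz => ?_
  rw [mem_ofPred_eq, Classical.not_imp] at hz
  have hzI : z.2 ∈ I := hz.1.elim (fun h => h.1.2.2) (fun h => h.1.2)
  obtain ⟨hz1, hz2, -, -, hthr, -⟩ := hz.1.elim (fun h => h.2) (fun h => h.2)
  -- A point of `(1/m, 1)` forces `m ≥ 2`, so that `log m > 0`.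
  have hcard : 1 < D.card := by
    have h := (hI hzI).1.trans (hI hzI).2
    rw [div_lt_one (by exact_mod_cast hcard0)] at h
    exact_mod_cast h
  have hp := collisionProb_lt_one p hI01 hI_open ⟨_, hzI⟩ hI_norm
  have hroot : ∀ c ∈ classB D, ¬ IsDoubleRoot c z.1 ∨ (z.1 ∈ I ∧ ¬ IsDoubleRoot c z.2) := by
    intro c hc
    rcases hz.1 with h | h
    · rcases not_and_or.1 (hR_root z h.1.1 c hc) with h1 | h1
      · exact Or.inl h1
      · exact Or.inr ⟨h.1.2.1, h1⟩
    · exact Or.inl (hJ_root c hc _ h.1.1)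
  obtain ⟨N, hN, hae⟩ := exists_nhds_ae_hasL2Density p hp hI_open hI_norm hz1 hz2 hzI
    (collisionProb_lt_of_threshold_lt hcard p hp (mul_pos hz1.1 hz2.1) hthr) hroot
  refine ⟨_, inter_mem_nhdsWithin _ hN, measure_mono_null ?_ (ae_iff.1 hae)⟩
  rintro y ⟨hy, hyN⟩ hy'
  exact hy fun _ => hy' hyN
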